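/- Let $\gamma_n$ be the standard Gaussian measure on $\mathbb{R}^n$; all expectations and probabilities are with respect to it, and all functions below are Borel. For a Borel set $A\subseteq\mathbb{R}^n$ let $\Gamma(A)=\liminf_{\delta\downarrow 0}\gamma_n(A_\delta\setminus A)/\delta\in[0,\infty]$ with $A_\delta=\{x:d(x,A)\le\delta\}$, and for $g:\mathbb{R}^n\to\{-1,1\}$ let $\mathsf{surf}(g)=\Gamma(\{g=1\})$. Call $f:\mathbb{R}^n\to\{-1,1\}$ $(\eta,s)$-smooth if there is $g:\mathbb{R}^n\to\{-1,1\}$ with $\mathbf{E}|f-g|\le\eta$ and $\mathsf{surf}(g)\le s(1+\eta)$. A linear $k$-junta is a function $h:\mathbb{R}^n\to\{-1,1\}$ of the form $h(x)=\phi(\langle u_1,x\rangle,\dots,\langle u_m,x\rangle)$ with $m\le k$, $u_1,\dots,u_m$ orthonormal and $\phi$ Borel; $f$ is $\epsilon$-far from every linear $k$-junta if $\mathbf{E}|f-h|\ge\epsilon$ for every linear $k$-junta $h$ (this holds in particular if $\Pr[f\neq h]\ge\epsilon$ for every such $h$). For $t>0$ let $P_tf(x)=\int f(e^{-t}x+\sqrt{1-e^{-2t}}\,z)\,d\gamma_n(z)$.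 Lemma 3.9. There is an absolute constant $c>0$ such that the following holds for all integers $n,k\ge 0$ and all reals $\epsilon,s>0$. Let $f:\mathbb{R}^n\to\{-1,1\}$ be $((\epsilon/30)^2,s)$-smooth and $\epsilon$-far from every linear $k$-junta, and let $t=\epsilon^4/(900s^2)$. Then for every linear subspace $W\subseteq\mathbb{R}^n$ of codimension at most $k$, $$\Pr_{y\sim\gamma_n}\Big[\big\|\mathrm{proj}_W\,D(P_tf)(y)\big\|_2^2\ge\frac{\epsilon^2}{8}\Big]\ \ge\ c\,\frac{\epsilon^6}{s^2},$$ where $D$ is the gradient and $\mathrm{proj}_W$ the orthogonal projection onto $W$. -/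

import Mathlib

open MeasureTheory ProbabilityTheory Filter Topology
open scoped ENNReal

namespace LinearJunta

/-- `ℝⁿ` with its Euclidean inner product and norm. -/
abbrev Space (n : ℕ) : Type := EuclideanSpace ℝ (Fin n)

/-- The standard Gaussian measure `γₙ` on `ℝⁿ`. -/
noncomputable def gauss (n : ℕ) : Measure (Space n) := stdGaussian (Space n)

/-- A Borel function `ℝⁿ → {-1, 1}`, viewed as a real-valued function. -/
def IsBoolean {n : ℕ} (f : Space n → ℝ) : Prop :=
  Measurable f ∧ ∀ x, f x = -1 ∨ f x = 1

/-- The `ℓ₁` distance `E |f - g|` with respect to the Gaussian measure. For `{-1, 1}`-valued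
functions this is twice the probability that `f` and `g` differ. -/
noncomputable def dist1 {n : ℕ} (f g : Space n → ℝ) : ℝ :=
  ∫ x, |f x - g x| ∂(gauss n)

/-- Gaussian surface area of a set: `liminf` of `γₙ(A_δ \ A) / δ` as `δ` decreases to `0`, where
`A_δ = {x : d(x, A) ≤ δ}`. -/
noncomputable def surfaceArea {n : ℕ} (A : Set (Space n)) : ℝ≥0∞ :=
  liminf (fun δ : ℝ => gauss n (Metric.cthickening δ A \ A) / ENNReal.ofReal δ) (𝓝[>] 0)

/-- The surface area of a `{-1, 1}`-valued function is that of the set where it equals `1`. -/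
noncomputable def surf {n : ℕ} (f : Space n → ℝ) : ℝ≥0∞ := surfaceArea {x | f x = 1}

/-- `f` is `(η, s)`-smooth: it is `η`-close in `ℓ₁` to a `{-1, 1}`-valued function of surface area
at most `s (1 + η)`. -/
def IsSmooth {n : ℕ} (η s : ℝ) (f : Space n → ℝ) : Prop :=
  ∃ g : Space n → ℝ, IsBoolean g ∧ dist1 f g ≤ η ∧ surf g ≤ ENNReal.ofReal (s * (1 + η))

/-- `f` is a (Borel) linear `k`-junta: it is a Borel function of the inner products with at most
`k` orthonormal vectors. -/
def IsLinearJunta {n : ℕ} (k : ℕ) (f : Space n → ℝ) : Prop :=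
  ∃ m : ℕ, m ≤ k ∧ ∃ u : Fin m → Space n, Orthonormal ℝ u ∧
    ∃ g : (Fin m → ℝ) → ℝ, Measurable g ∧ ∀ x, f x = g (fun i => inner ℝ (u i) x)

/-- `f` is `ε`-far from every `{-1, 1}`-valued linear `k`-junta. -/
def IsFarFromLinearJuntas {n : ℕ} (ε : ℝ) (k : ℕ) (f : Space n → ℝ) : Prop :=
  ∀ h : Space n → ℝ, IsBoolean h → IsLinearJunta k h → ε ≤ dist1 f h

/-- The Ornstein-Uhlenbeck operator `P_t`. -/
noncomputable def ouSemigroup {n : ℕ} (t : ℝ) (f : Space n → ℝ) (x : Space n) : ℝ :=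
  ∫ z, f (Real.exp (-t) • x + Real.sqrt (1 - Real.exp (-2 * t)) • z) ∂(gauss n)

end LinearJunta

namespace LinearJunta

/-! ### Basic facts on the Gaussian measure -/

section GaussianFacts

/-! Write `P` for the projection onto `W`, `F = P_t f`, `q = √(2t)`. Everything is compared along
one family of maps of a pair `(x, z)` of independent Gaussians: rotate the `W`-components by `θ` and
keep the first entry. At `θ = π/2` this replaces `Px` by `Pz`; for fixed `z` the result is a linear
`k`-junta of `x`, so farness makes the mean change of `f` at least `ε`
(`IsFarFromLinearJuntas.le_integral`).

Passing from `f` to `F` costs `2 E|f - F|`, and for the Lipschitz function `F` the mean change is at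
most `π/2 · E‖P∇F‖` (`integral_abs_sub_partialRotation_le`). With `W = ⊤` and `cos θ = e^{-t}` the
same rotation is Ornstein-Uhlenbeck noise, so applying that bound to Lipschitz approximations of an
indicator shows that surface area controls noise sensitivity, hence `E|f - F|`
(`IsSmooth.dist1_ouSemigroup_le`). Thus `E‖P∇F‖` is at least a constant times `ε`.

Finally `‖∇F‖ ≤ 2/q` everywhere (`lipschitzWith_ouSemigroup`), so a large mean forces `‖P∇F‖` to be
large with probability of order `εq`, that is `ε³/s`. Squaring this probability gives the stated
bound. -/

instance isProbabilityMeasure_gauss (n : ℕ) : IsProbabilityMeasure (gauss n) := by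
  unfold gauss; infer_instance

instance isGaussian_gauss (n : ℕ) : IsGaussian (gauss n) := by
  unfold gauss; infer_instance

theorem pi_absolutelyContinuous {n : ℕ} (μ ν : Measure ℝ) [SigmaFinite μ] [SigmaFinite ν]
    (h : μ ≪ ν) :
    Measure.pi (fun _ : Fin n ↦ μ) ≪ Measure.pi (fun _ : Fin n ↦ ν) := by
  induction n with
  | zero => rw [Measure.pi_of_empty (fun _ ↦ μ) Fin.elim0, Measure.pi_of_empty (fun _ ↦ ν) Fin.elim0]
  | succ n ih =>
    have hμ := (measurePreserving_piFinSuccAbove (fun _ : Fin (n + 1) ↦ μ) 0).symm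
    have hν := (measurePreserving_piFinSuccAbove (fun _ : Fin (n + 1) ↦ ν) 0).symm
    rw [← hμ.map_eq, ← hν.map_eq]
    exact (h.prod ih).map hμ.measurable

/-- Lets Rademacher's theorem, a statement about Lebesgue measure, be used almost surely under
`gauss n`. -/
theorem gauss_absolutelyContinuous (n : ℕ) : gauss n ≪ volume := by
  rw [gauss, ← map_pi_eq_stdGaussian, ← (PiLp.volume_preserving_toLp (Fin n)).map_eq]
  exact (pi_absolutelyContinuous _ _ (gaussianReal_absolutelyContinuous 0 one_ne_zero)).map
    (by fun_prop)

/-- The `L¹` norm is at most the `L²` norm. -/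
theorem integral_abs_le_of_integral_sq_le {Ω : Type*} [MeasurableSpace Ω] {μ : Measure Ω}
    [IsProbabilityMeasure μ] {X : Ω → ℝ} (hX : MemLp X 2 μ) {C : ℝ} (hC : 0 ≤ C)
    (h : ∫ ω, X ω ^ 2 ∂μ ≤ C ^ 2) : ∫ ω, |X ω| ∂μ ≤ C := by
  have h1 := variance_nonneg (fun ω ↦ |X ω|) μ
  have hX' : MemLp (fun ω ↦ |X ω|) 2 μ := hX.abs
  rw [variance_eq_sub hX'] at h1
  have h2 : ∫ ω, ((fun ω ↦ |X ω|) ^ 2) ω ∂μ = ∫ ω, X ω ^ 2 ∂μ := by simp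
  rw [h2] at h1
  exact abs_le_of_sq_le_sq' (by linarith) hC |>.2

theorem integral_abs_inner_le {n : ℕ} (v : Space n) :
    ∫ z, |inner ℝ v z| ∂(gauss n) ≤ ‖v‖ := by
  have hL : MemLp (fun z ↦ inner ℝ v z) 2 (gauss n) :=
    IsGaussian.memLp_dual (gauss n) (innerSL ℝ v) 2 (by norm_num)
  refine integral_abs_le_of_integral_sq_le hL (norm_nonneg v) (le_of_eq ?_)
  have h := variance_dual_stdGaussian (E := Space n) (innerSL ℝ v)
  have h0 : ∫ z, inner ℝ v z ∂(gauss n) = 0 :=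
    integral_strongDual_stdGaussian (E := Space n) (innerSL ℝ v)
  rw [innerSL_apply_norm] at h
  rw [← h]
  change _ = variance (fun z ↦ inner ℝ v z) (gauss n)
  rw [variance_eq_sub hL, h0]
  simp

theorem integrable_norm_gauss (n : ℕ) : Integrable (fun x : Space n ↦ ‖x‖) (gauss n) :=
  (IsGaussian.integrable_id (μ := gauss n)).norm

theorem charFun_gauss {n : ℕ} (t : Space n) :
    charFun (gauss n) t = Complex.exp (-‖t‖ ^ 2 / 2) :=
  charFun_stdGaussian t

end GaussianFacts

/-! ### Rotating the `W`-components of a Gaussian pair -/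

section PartialRotation

variable {n : ℕ}

/-- Rotation by the angle `θ` of the `W`-components in the pair `p`; the component orthogonal to
`W` is left unchanged. Only the first entry of the rotated pair is recorded. -/
noncomputable def partialRotation (W : Submodule ℝ (Space n)) (θ : ℝ) (p : Space n × Space n) :
    Space n :=
  p.1 - W.starProjection p.1 + Real.cos θ • W.starProjection p.1
    + Real.sin θ • W.starProjection p.2

/-- The rotated pair. -/
noncomputable def partialRotationPair (W : Submodule ℝ (Space n)) (θ : ℝ)
    (p : Space n × Space n) : Space n × Space n :=
  (partialRotation W θ p,
    p.2 - W.starProjection p.2 + Real.cos θ • W.starProjection p.2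
      - Real.sin θ • W.starProjection p.1)

variable (W : Submodule ℝ (Space n))

theorem continuous_partialRotation (θ : ℝ) : Continuous (partialRotation W θ) := by
  unfold partialRotation; fun_prop

theorem continuous_partialRotationPair (θ : ℝ) : Continuous (partialRotationPair W θ) := by
  unfold partialRotationPair partialRotation; fun_prop

theorem starProjection_starProjection (x : Space n) :
    W.starProjection (W.starProjection x) = W.starProjection x :=
  Submodule.starProjection_eq_self_iff.2 (W.starProjection_apply_mem x)

theorem inner_starProjection_comm (x y : Space n) :
    inner ℝ (W.starProjection x) y = inner ℝ x (W.starProjection y) :=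
  W.inner_starProjection_left_eq_right x y

/-- The group law of rotations; it is what allows a large angle to be cut into equal small ones. -/
theorem partialRotation_partialRotationPair (θ η : ℝ) (p : Space n × Space n) :
    partialRotation W η (partialRotationPair W θ p) = partialRotation W (θ + η) p := by
  simp only [partialRotation, partialRotationPair, map_add, map_sub, map_smul,
    starProjection_starProjection, Real.cos_add, Real.sin_add]
  module

/-- The two vectors form the adjoint of `partialRotationPair W θ` applied to `(a, b)`, so this says
that the adjoint is an isometry. -/
theorem norm_sq_add_norm_sq_partialRotation (θ : ℝ) (a b : Space n) :
    ‖partialRotation W (-θ) (a, b)‖ ^ 2 + ‖partialRotation W θ (b, a)‖ ^ 2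
      = ‖a‖ ^ 2 + ‖b‖ ^ 2 := by
  have h (x y : Space n) : inner ℝ (W.starProjection x) y
      = inner ℝ (W.starProjection x) (W.starProjection y) := by
    rw [inner_starProjection_comm, inner_starProjection_comm, starProjection_starProjection]
  have h' (x y : Space n) : inner ℝ y (W.starProjection x)
      = inner ℝ (W.starProjection x) (W.starProjection y) := by
    rw [real_inner_comm, h]
  simp only [partialRotation, Real.cos_neg, Real.sin_neg, ← real_inner_self_eq_norm_sq,
    inner_add_left, inner_add_right, inner_sub_left, inner_sub_right, real_inner_smul_left,
    real_inner_smul_right, h a b, h' a b, h b a, h' b a, h a a, h' a a, h b b, h' b b]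
  rw [real_inner_comm (W.starProjection b) (W.starProjection a)]
  linear_combination (inner ℝ (W.starProjection a) (W.starProjection a)
    + inner ℝ (W.starProjection b) (W.starProjection b)) * Real.sin_sq_add_cos_sq θ

/-- The characteristic function of the pair depends only on the norm of its argument, and a linear
change of variable acts on that argument through an isometric adjoint. -/
theorem measurePreserving_partialRotationPair (θ : ℝ) :
    MeasurePreserving (partialRotationPair W θ) ((gauss n).prod (gauss n))
      ((gauss n).prod (gauss n)) := by
  have hm := (continuous_partialRotationPair W θ).measurable
  refine ⟨hm, ?_⟩
  have : IsProbabilityMeasure (((gauss n).prod (gauss n)).map (partialRotationPair W θ)) :=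
    Measure.isProbabilityMeasure_map hm.aemeasurable
  refine charFun_eq_prod_iff.1 fun t ↦ ?_
  set a := (WithLp.ofLp t).1
  set b := (WithLp.ofLp t).2
  have key : charFun ((((gauss n).prod (gauss n)).map (partialRotationPair W θ)).map
      (WithLp.toLp 2)) t = charFun (((gauss n).prod (gauss n)).map (WithLp.toLp 2))
      (WithLp.toLp 2 (partialRotation W (-θ) (a, b), partialRotation W θ (b, a))) := by
    rw [Measure.map_map (by fun_prop) hm, charFun_apply, charFun_apply,
      integral_map (by fun_prop) (by fun_prop), integral_map (by fun_prop) (by fun_prop)]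
    refine integral_congr_ae (Eventually.of_forall fun p ↦ ?_)
    have : inner ℝ (WithLp.toLp 2 (partialRotationPair W θ p)) t = inner ℝ (WithLp.toLp 2 p)
        (WithLp.toLp 2 (partialRotation W (-θ) (a, b), partialRotation W θ (b, a))) := by
      simp only [WithLp.prod_inner_apply, partialRotationPair, partialRotation, inner_add_left,
        inner_sub_left, inner_add_right, inner_sub_right, real_inner_smul_left,
        real_inner_smul_right, inner_starProjection_comm, Real.cos_neg, Real.sin_neg]
      simp only [a, b]
      ring
    simp only [Function.comp_apply, this]
  rw [key, charFun_prod]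
  simp only [charFun_gauss]
  rw [← Complex.exp_add, ← Complex.exp_add]
  have := norm_sq_add_norm_sq_partialRotation W θ a b
  congr 1
  have h2 : ((‖partialRotation W (-θ) (a, b)‖ : ℂ)) ^ 2 + (‖partialRotation W θ (b, a)‖ : ℂ) ^ 2
      = (‖a‖ : ℂ) ^ 2 + (‖b‖ : ℂ) ^ 2 := by exact_mod_cast this
  linear_combination (-1 / 2) * h2

theorem measurePreserving_partialRotation (θ : ℝ) :
    MeasurePreserving (partialRotation W θ) ((gauss n).prod (gauss n)) (gauss n) :=
  measurePreserving_fst.comp (measurePreserving_partialRotationPair W θ)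

theorem norm_partialRotation_sub_le (θ : ℝ) (p : Space n × Space n) :
    ‖partialRotation W θ p - p.1‖ ≤ |θ| * (‖p.1‖ + ‖p.2‖) := by
  have h : partialRotation W θ p - p.1 = (Real.cos θ - 1) • W.starProjection p.1
      + Real.sin θ • W.starProjection p.2 := by
    unfold partialRotation; module
  have hc : |Real.cos θ - 1| ≤ |θ| := by
    have := Real.abs_cos_sub_cos_le θ 0
    simpa using this
  have hs : |Real.sin θ| ≤ |θ| := Real.abs_sin_le_abs
  rw [h, mul_add]
  refine (norm_add_le _ _).trans (add_le_add ?_ ?_) <;> rw [norm_smul, Real.norm_eq_abs]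
  · exact mul_le_mul hc (W.norm_starProjection_apply_le _) (norm_nonneg _) (abs_nonneg _)
  · exact mul_le_mul hs (W.norm_starProjection_apply_le _) (norm_nonneg _) (abs_nonneg _)

theorem hasDerivAt_partialRotation_zero (p : Space n × Space n) :
    HasDerivAt (fun θ ↦ partialRotation W θ p) (W.starProjection p.2) 0 := by
  unfold partialRotation
  have hc := (Real.hasDerivAt_cos 0).smul_const (W.starProjection p.1)
  have hs := (Real.hasDerivAt_sin 0).smul_const (W.starProjection p.2)
  exact ((hc.const_add (p.1 - W.starProjection p.1)).add hs).congr_deriv (by simp)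

theorem partialRotation_zero (p : Space n × Space n) : partialRotation W 0 p = p.1 := by
  simp [partialRotation]

end PartialRotation

/-! ### Lipschitz functions under rotation -/

section LipschitzRotation

variable {n : ℕ} (W : Submodule ℝ (Space n)) {φ : Space n → ℝ} {L : NNReal}

theorem abs_sub_partialRotation_le (hφ : LipschitzWith L φ) (θ : ℝ) (p : Space n × Space n) :
    |φ p.1 - φ (partialRotation W θ p)| ≤ L * (|θ| * (‖p.1‖ + ‖p.2‖)) := by
  rw [← Real.dist_eq, dist_comm]
  refine (hφ.dist_le_mul _ _).trans ?_
  rw [dist_eq_norm]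
  exact mul_le_mul_of_nonneg_left (norm_partialRotation_sub_le W θ p) L.2

theorem integrable_norm_fst_add_norm_snd (n : ℕ) :
    Integrable (fun p : Space n × Space n ↦ ‖p.1‖ + ‖p.2‖) ((gauss n).prod (gauss n)) :=
  ((integrable_norm_gauss n).comp_fst _).add ((integrable_norm_gauss n).comp_snd _)

theorem integrable_abs_sub_partialRotation (hφ : LipschitzWith L φ) (θ : ℝ) :
    Integrable (fun p ↦ |φ p.1 - φ (partialRotation W θ p)|) ((gauss n).prod (gauss n)) := by
  refine (((integrable_norm_fst_add_norm_snd n).const_mul |θ|).const_mul (L : ℝ)).mono' ?_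
    (Eventually.of_forall fun p ↦ ?_)
  · have h1 := hφ.continuous
    have h2 := continuous_partialRotation W θ
    exact Continuous.aestronglyMeasurable (by fun_prop)
  · rw [Real.norm_eq_abs, abs_abs]
    exact abs_sub_partialRotation_le W hφ θ p

/-- Telescoping: by the group law and invariance of the measure, each of the `N` steps contributes
the same amount. -/
theorem integral_abs_sub_partialRotation_nat_mul_le (hφ : LipschitzWith L φ) (θ : ℝ) (N : ℕ) :
    ∫ p, |φ p.1 - φ (partialRotation W (N * θ) p)| ∂((gauss n).prod (gauss n))
      ≤ N * ∫ p, |φ p.1 - φ (partialRotation W θ p)| ∂((gauss n).prod (gauss n)) := by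
  induction N with
  | zero => simp [partialRotation_zero]
  | succ N ih =>
    have hmp := measurePreserving_partialRotationPair W (N * θ)
    have hint := integrable_abs_sub_partialRotation W hφ θ
    have hcomp := hmp.integrable_comp_of_integrable hint
    have hval : ∫ p, |φ (partialRotation W (N * θ) p)
        - φ (partialRotation W ((N + 1 : ℕ) * θ) p)| ∂((gauss n).prod (gauss n))
        = ∫ p, |φ p.1 - φ (partialRotation W θ p)| ∂((gauss n).prod (gauss n)) := by
      conv_rhs => rw [← hmp.map_eq]
      rw [integral_map hmp.measurable.aemeasurable (by rw [hmp.map_eq]; exact hint.1)]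
      simp_rw [partialRotation_partialRotationPair]
      push_cast
      simp_rw [add_mul, one_mul]
      rfl
    have hint' : Integrable (fun p ↦ |φ (partialRotation W (N * θ) p)
        - φ (partialRotation W ((N + 1 : ℕ) * θ) p)|) ((gauss n).prod (gauss n)) := by
      refine hcomp.congr (Eventually.of_forall fun p ↦ ?_)
      simp only [Function.comp_apply, partialRotation_partialRotationPair]
      push_cast
      rw [add_mul, one_mul]
      rfl
    calc _ ≤ ∫ p, (|φ p.1 - φ (partialRotation W (N * θ) p)|
          + |φ (partialRotation W (N * θ) p) - φ (partialRotation W ((N + 1 : ℕ) * θ) p)|)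
            ∂((gauss n).prod (gauss n)) :=
          integral_mono (integrable_abs_sub_partialRotation W hφ _)
            ((integrable_abs_sub_partialRotation W hφ _).add hint') fun p ↦ abs_sub_le _ _ _
      _ ≤ _ := by
          rw [integral_add (integrable_abs_sub_partialRotation W hφ _) hint', hval]
          push_cast
          linarith

theorem ae_differentiableAt_gauss (hφ : LipschitzWith L φ) :
    ∀ᵐ x ∂(gauss n), DifferentiableAt ℝ φ x :=
  (gauss_absolutelyContinuous n).ae_le (hφ.ae_differentiableAt (μ := volume))

/-- Rotating the `W`-components by the angle `θ` changes a Lipschitz function by at most `θ` times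
its mean directional derivative, in `L¹`. -/
theorem integral_abs_sub_partialRotation_le_fderiv (hφ : LipschitzWith L φ) {θ : ℝ} (hθ : 0 ≤ θ) :
    ∫ p, |φ p.1 - φ (partialRotation W θ p)| ∂((gauss n).prod (gauss n))
      ≤ θ * ∫ p : Space n × Space n, |fderiv ℝ φ p.1 (W.starProjection p.2)|
          ∂((gauss n).prod (gauss n)) := by
  set γ₂ := (gauss n).prod (gauss n) with hγ₂
  -- Difference quotients at angle `θ / (N + 1)` converge by Rademacher and are dominated by the
  -- Lipschitz bound; telescoping bounds the left side by every term of the sequence.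
  have hlim : Tendsto (fun N : ℕ ↦ ∫ p, ((N + 1 : ℕ) : ℝ)
      * |φ p.1 - φ (partialRotation W (θ / (N + 1 : ℕ)) p)| ∂γ₂) atTop
      (𝓝 (∫ p, θ * |fderiv ℝ φ p.1 (W.starProjection p.2)| ∂γ₂)) := by
    refine tendsto_integral_of_dominated_convergence
      (fun p ↦ L * (θ * (‖p.1‖ + ‖p.2‖))) ?_ ?_ ?_ ?_
    · exact fun N ↦ (integrable_abs_sub_partialRotation W hφ _).1.const_mul _
    · exact ((integrable_norm_fst_add_norm_snd n).const_mul θ).const_mul _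
    · refine fun N ↦ Eventually.of_forall fun p ↦ ?_
      rw [Real.norm_eq_abs, abs_mul, abs_abs, Nat.abs_cast]
      have hN : (0 : ℝ) < (N + 1 : ℕ) := by positivity
      calc _ ≤ ((N + 1 : ℕ) : ℝ) * (L * (|θ / (N + 1 : ℕ)| * (‖p.1‖ + ‖p.2‖))) :=
            mul_le_mul_of_nonneg_left (abs_sub_partialRotation_le W hφ _ p) hN.le
        _ = _ := by
            rw [abs_div, abs_of_nonneg hθ, abs_of_pos hN]
            field_simp
    · have hd : ∀ᵐ p ∂γ₂, DifferentiableAt ℝ φ p.1 :=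
        Measure.quasiMeasurePreserving_fst.ae (ae_differentiableAt_gauss hφ)
      filter_upwards [hd] with p hp
      have hp' : HasFDerivAt φ (fderiv ℝ φ p.1) (partialRotation W 0 p) := by
        rw [partialRotation_zero]; exact hp.hasFDerivAt
      have h1 := hp'.comp_hasDerivAt (0 : ℝ) (hasDerivAt_partialRotation_zero W p)
      have h2 : HasDerivAt (fun u : ℝ ↦ φ (partialRotation W (u * θ) p))
          (fderiv ℝ φ p.1 (W.starProjection p.2) * θ) 0 := by
        have h3 : HasDerivAt (fun u : ℝ ↦ u * θ) θ 0 := by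
          simpa using (hasDerivAt_id (0 : ℝ)).mul_const θ
        have h1' : HasDerivAt (φ ∘ fun θ ↦ partialRotation W θ p)
          (fderiv ℝ φ p.1 (W.starProjection p.2)) (0 * θ) := by rwa [zero_mul]
        exact h1'.comp (0 : ℝ) h3
      have h4 := h2.tendsto_slope_zero_right
      have h5 : Tendsto (fun N : ℕ ↦ (((N + 1 : ℕ) : ℝ))⁻¹) atTop (𝓝[>] 0) := by
        refine tendsto_inv_atTop_nhdsGT_zero.comp ?_
        exact tendsto_natCast_atTop_atTop.comp (tendsto_add_atTop_nat 1)
      have h6 := (h4.comp h5).abs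
      rw [abs_mul, abs_of_nonneg hθ] at h6
      rw [mul_comm θ]
      refine h6.congr fun N ↦ ?_
      have hN : (0 : ℝ) < (N + 1 : ℕ) := by positivity
      simp only [Function.comp_apply, zero_add, zero_mul, partialRotation_zero, inv_inv,
        smul_eq_mul]
      rw [abs_mul, Nat.abs_cast, abs_sub_comm, div_eq_inv_mul]
  rw [← integral_const_mul]
  refine ge_of_tendsto hlim (Eventually.of_forall fun N ↦ ?_)
  rw [integral_const_mul]
  have := integral_abs_sub_partialRotation_nat_mul_le W hφ (θ / (N + 1 : ℕ)) (N + 1)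
  have hN : ((N + 1 : ℕ) : ℝ) ≠ 0 := by positivity
  rwa [mul_div_cancel₀ _ hN] at this

theorem norm_gradient_le (hφ : LipschitzWith L φ) (x : Space n) : ‖gradient φ x‖ ≤ L := by
  rw [gradient, LinearIsometryEquiv.norm_map]
  exact norm_fderiv_le_of_lipschitz ℝ hφ

theorem measurable_gradient (φ : Space n → ℝ) : Measurable (gradient φ) :=
  (LinearIsometryEquiv.continuous _).measurable.comp (measurable_fderiv ℝ φ)

theorem measurable_starProjection_gradient (φ : Space n → ℝ) :
    Measurable fun x ↦ W.starProjection (gradient φ x) :=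
  W.starProjection.continuous.measurable.comp (measurable_gradient φ)

theorem integrable_norm_starProjection_gradient (hφ : LipschitzWith L φ) :
    Integrable (fun x ↦ ‖W.starProjection (gradient φ x)‖) (gauss n) := by
  refine Integrable.of_bound (C := L) ?_ (Eventually.of_forall fun x ↦ ?_)
  · exact (measurable_starProjection_gradient W φ).norm.aestronglyMeasurable
  · rw [norm_norm]
    exact (W.norm_starProjection_apply_le _).trans (norm_gradient_le hφ x)

/-- Given `x`, the directional derivative is a centred Gaussian in `z` with standard deviation
`‖P∇φ(x)‖`, which bounds its mean absolute value. -/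
theorem integral_abs_sub_partialRotation_le (hφ : LipschitzWith L φ) {θ : ℝ} (hθ : 0 ≤ θ) :
    ∫ p, |φ p.1 - φ (partialRotation W θ p)| ∂((gauss n).prod (gauss n))
      ≤ θ * ∫ x, ‖W.starProjection (gradient φ x)‖ ∂(gauss n) := by
  refine (integral_abs_sub_partialRotation_le_fderiv W hφ hθ).trans
    (mul_le_mul_of_nonneg_left ?_ hθ)
  have heq (p : Space n × Space n) : fderiv ℝ φ p.1 (W.starProjection p.2)
      = inner ℝ (W.starProjection (gradient φ p.1)) p.2 := by
    rw [inner_starProjection_comm, gradient, InnerProductSpace.toDual_symm_apply]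
  simp_rw [heq]
  have hmeas := measurable_starProjection_gradient W φ
  have hint : Integrable (fun p : Space n × Space n ↦
      |inner ℝ (W.starProjection (gradient φ p.1)) p.2|) ((gauss n).prod (gauss n)) := by
    refine ((integrable_norm_gauss n).comp_snd (gauss n) |>.const_mul (L : ℝ)).mono' ?_
      (Eventually.of_forall fun p ↦ ?_)
    · have h := (hmeas.comp measurable_fst).inner (𝕜 := ℝ) (measurable_snd (α := Space n))
      exact h.abs.aestronglyMeasurable
    · rw [Real.norm_eq_abs, abs_abs]
      refine (abs_real_inner_le_norm _ _).trans (mul_le_mul_of_nonneg_right ?_ (norm_nonneg _))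
      exact (W.norm_starProjection_apply_le _).trans (norm_gradient_le hφ _)
  rw [integral_prod _ hint]
  refine integral_mono ?_ ?_ ?_
  · exact hint.integral_prod_left
  · exact integrable_norm_starProjection_gradient W hφ
  · intro x
    exact integral_abs_inner_le (W.starProjection (gradient φ x))

end LipschitzRotation

/-! ### Surface area bounds noise sensitivity -/

section SurfaceArea

variable {n : ℕ}

theorem integrable_abs_sub_partialRotation_of_integrable (W : Submodule ℝ (Space n)) (θ : ℝ)
    {f g : Space n → ℝ} (hf : Integrable f (gauss n)) (hg : Integrable g (gauss n)) :
    Integrable (fun p ↦ |f p.1 - g (partialRotation W θ p)|) ((gauss n).prod (gauss n)) :=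
  ((hf.comp_fst (gauss n)).sub
    ((measurePreserving_partialRotation W θ).integrable_comp_of_integrable hg)).abs

/-- The `L¹` change under a partial rotation is stable under `L¹` perturbations. -/
theorem integral_abs_sub_partialRotation_le_add (W : Submodule ℝ (Space n)) (θ : ℝ)
    {f g : Space n → ℝ} (hf : Integrable f (gauss n)) (hg : Integrable g (gauss n)) :
    ∫ p, |f p.1 - f (partialRotation W θ p)| ∂((gauss n).prod (gauss n))
      ≤ 2 * ∫ x, |f x - g x| ∂(gauss n)
        + ∫ p, |g p.1 - g (partialRotation W θ p)| ∂((gauss n).prod (gauss n)) := by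
  have hmp := measurePreserving_partialRotation W θ
  have hd : Integrable (fun x ↦ |f x - g x|) (gauss n) := (hf.sub hg).abs
  have h1 : ∫ p : Space n × Space n, |f p.1 - g p.1| ∂((gauss n).prod (gauss n))
      = ∫ x, |f x - g x| ∂(gauss n) := by
    have h := integral_map (μ := (gauss n).prod (gauss n)) (φ := Prod.fst)
      measurable_fst.aemeasurable (f := fun x ↦ |f x - g x|)
      (by rw [measurePreserving_fst.map_eq]; exact hd.1)
    rw [← h, measurePreserving_fst.map_eq]
  have h2 : ∫ p : Space n × Space n, |f (partialRotation W θ p) - g (partialRotation W θ p)|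
      ∂((gauss n).prod (gauss n)) = ∫ x, |f x - g x| ∂(gauss n) := by
    have h := integral_map (μ := (gauss n).prod (gauss n)) (φ := partialRotation W θ)
      hmp.measurable.aemeasurable (f := fun x ↦ |f x - g x|)
      (by rw [hmp.map_eq]; exact hd.1)
    rw [← h, hmp.map_eq]
  have i1 : Integrable (fun p : Space n × Space n ↦ |f p.1 - g p.1|)
      ((gauss n).prod (gauss n)) := hd.comp_fst _
  have i2 : Integrable (fun p ↦ |f (partialRotation W θ p) - g (partialRotation W θ p)|)
      ((gauss n).prod (gauss n)) := hmp.integrable_comp_of_integrable hd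
  have i12 : Integrable (fun p ↦ |f p.1 - g p.1|
      + |f (partialRotation W θ p) - g (partialRotation W θ p)|)
      ((gauss n).prod (gauss n)) := i1.add i2
  have i3 := integrable_abs_sub_partialRotation_of_integrable W θ hg hg
  calc _ ≤ ∫ p, (|f p.1 - g p.1| + |f (partialRotation W θ p) - g (partialRotation W θ p)|
        + |g p.1 - g (partialRotation W θ p)|) ∂((gauss n).prod (gauss n)) := by
        refine integral_mono (integrable_abs_sub_partialRotation_of_integrable W θ hf hf)
          (i12.add i3) fun p ↦ ?_
        have e : f p.1 - f (partialRotation W θ p) = (f p.1 - g p.1)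
          - (f (partialRotation W θ p) - g (partialRotation W θ p))
          + (g p.1 - g (partialRotation W θ p)) := by ring
        simp only [e]
        exact (abs_add_le _ _).trans (add_le_add_left (abs_sub _ _) _)
    _ = _ := by
        rw [integral_add i12 i3, integral_add i1 i2, h1, h2]
        ring

theorem lipschitzWith_coe_thickenedIndicator {r : ℝ} (hr : 0 < r) (A : Set (Space n)) :
    LipschitzWith r.toNNReal⁻¹ (fun x ↦ (thickenedIndicator hr A x : ℝ)) := by
  have h := NNReal.isometry_coe.lipschitz.comp (lipschitzWith_thickenedIndicator hr A)
  rwa [one_mul] at h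

/-- Off the shell the function attains its global maximum `1` or minimum `0`, so no regularity of
`A` is needed. -/
theorem gradient_thickenedIndicator_eq_zero {r : ℝ} (hr : 0 < r) (A : Set (Space n)) {x : Space n}
    (hx : x ∉ Metric.cthickening r A \ A) :
    gradient (fun x ↦ (thickenedIndicator hr A x : ℝ)) x = 0 := by
  have hfd : fderiv ℝ (fun x ↦ (thickenedIndicator hr A x : ℝ)) x = 0 := by
    by_cases hA : x ∈ A
    · refine IsLocalMax.fderiv_eq_zero (Eventually.of_forall fun y ↦ ?_)
      simp only [thickenedIndicator_one hr A hA]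
      exact_mod_cast thickenedIndicator_le_one hr A y
    · refine IsLocalMin.fderiv_eq_zero (Eventually.of_forall fun y ↦ ?_)
      have hx' : x ∉ Metric.thickening r A := fun h ↦
        hx ⟨Metric.thickening_subset_cthickening r A h, hA⟩
      simp only [thickenedIndicator_zero hr A hx']
      exact NNReal.coe_nonneg _
  rw [gradient, hfd, map_zero]

theorem abs_indicator_sub_thickenedIndicator_le {r : ℝ} (hr : 0 < r) (A : Set (Space n))
    (x : Space n) :
    |A.indicator (fun _ ↦ (1 : ℝ)) x - thickenedIndicator hr A x|
      ≤ (Metric.cthickening r A \ A).indicator (fun _ ↦ (1 : ℝ)) x := by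
  by_cases hA : x ∈ A
  · simp [hA, thickenedIndicator_one hr A hA]
  · by_cases hx : x ∈ Metric.thickening r A
    · have h1 : x ∈ Metric.cthickening r A \ A :=
        ⟨Metric.thickening_subset_cthickening r A hx, hA⟩
      rw [Set.indicator_of_notMem hA, Set.indicator_of_mem h1, zero_sub, abs_neg,
        abs_of_nonneg (NNReal.coe_nonneg _)]
      exact_mod_cast thickenedIndicator_le_one hr A x
    · rw [Set.indicator_of_notMem hA, thickenedIndicator_zero hr A hx]
      simp [Set.indicator_nonneg]

/-- Replacing the indicator by its `1/r`-Lipschitz thickening costs twice the measure of the shell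
(the `2 * r` term); the gradient is at most `1/r` and lives on the shell (the `θ` term). -/
theorem integral_abs_indicator_sub_partialRotation_le_thickening {A : Set (Space n)}
    (hA : MeasurableSet A) {θ : ℝ} (hθ : 0 ≤ θ) {r : ℝ} (hr : 0 < r) :
    ∫ p, |A.indicator (fun _ ↦ (1 : ℝ)) p.1
        - A.indicator (fun _ ↦ (1 : ℝ)) (partialRotation ⊤ θ p)| ∂((gauss n).prod (gauss n))
      ≤ (2 * r + θ) * ((gauss n).real (Metric.cthickening r A \ A) / r) := by
  set S := Metric.cthickening r A \ A with hS
  have hSm : MeasurableSet S := Metric.isClosed_cthickening.measurableSet.diff hA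
  set φ : Space n → ℝ := fun x ↦ thickenedIndicator hr A x with hφ
  have hlip : LipschitzWith r.toNNReal⁻¹ φ := lipschitzWith_coe_thickenedIndicator hr A
  have hiA : Integrable (A.indicator (fun _ ↦ (1 : ℝ))) (gauss n) :=
    (integrable_const 1).indicator hA
  have hiφ : Integrable φ (gauss n) := by
    refine Integrable.of_bound (C := 1) hlip.continuous.aestronglyMeasurable
      (Eventually.of_forall fun x ↦ ?_)
    rw [Real.norm_eq_abs, abs_of_nonneg (NNReal.coe_nonneg _)]
    exact_mod_cast thickenedIndicator_le_one hr A x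
  have h1 : ∫ x, |A.indicator (fun _ ↦ (1 : ℝ)) x - φ x| ∂(gauss n) ≤ (gauss n).real S := by
    rw [← integral_indicator_one hSm]
    exact integral_mono (hiA.sub hiφ).abs ((integrable_const (1 : ℝ)).indicator hSm)
      (abs_indicator_sub_thickenedIndicator_le hr A)
  have h2 : ∫ x, ‖(⊤ : Submodule ℝ (Space n)).starProjection (gradient φ x)‖ ∂(gauss n)
      ≤ (gauss n).real S / r := by
    have : (gauss n).real S / r = ∫ x, S.indicator (fun _ ↦ r⁻¹) x ∂(gauss n) := by
      rw [integral_indicator_const _ hSm, smul_eq_mul, div_eq_mul_inv]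
    rw [this]
    refine integral_mono (integrable_norm_starProjection_gradient ⊤ hlip)
      ((integrable_const _).indicator hSm) fun x ↦ ?_
    by_cases hx : x ∈ S
    · rw [Set.indicator_of_mem hx]
      refine (Submodule.norm_starProjection_apply_le _ _).trans ((norm_gradient_le hlip x).trans ?_)
      rw [NNReal.coe_inv, Real.coe_toNNReal _ hr.le]
    · rw [Set.indicator_of_notMem hx]
      simp only [hφ, gradient_thickenedIndicator_eq_zero hr A hx, map_zero, norm_zero, le_refl]
  have h3 := integral_abs_sub_partialRotation_le_add ⊤ θ hiA hiφ
  have h4 := integral_abs_sub_partialRotation_le ⊤ hlip hθ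
  have h5 := mul_le_mul_of_nonneg_left h2 hθ
  have h6 : (2 * r + θ) * ((gauss n).real S / r)
      = 2 * (gauss n).real S + θ * ((gauss n).real S / r) := by field_simp
  rw [h6]
  linarith

/-- Noise sensitivity of a set is controlled by its Gaussian surface area. -/
theorem integral_abs_indicator_sub_partialRotation_le {A : Set (Space n)}
    (hA : MeasurableSet A) {θ s : ℝ} (hθ : 0 ≤ θ) (hs : 0 ≤ s)
    (hsurf : surfaceArea A ≤ ENNReal.ofReal s) :
    ∫ p, |A.indicator (fun _ ↦ (1 : ℝ)) p.1
        - A.indicator (fun _ ↦ (1 : ℝ)) (partialRotation ⊤ θ p)| ∂((gauss n).prod (gauss n))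
      ≤ θ * s := by
  have hlim : Tendsto (fun κ : ℝ ↦ (2 * κ + θ) * (s + κ)) (𝓝[>] 0) (𝓝 (θ * s)) := by
    have : Tendsto (fun κ : ℝ ↦ (2 * κ + θ) * (s + κ)) (𝓝 0) (𝓝 ((2 * 0 + θ) * (s + 0))) :=
      Continuous.tendsto (by fun_prop) 0
    simp only [mul_zero, zero_add, add_zero] at this
    exact this.mono_left nhdsWithin_le_nhds
  refine ge_of_tendsto hlim ?_
  filter_upwards [self_mem_nhdsWithin] with κ hκ
  have hκ : 0 < κ := hκ
  have hlt : surfaceArea A < ENNReal.ofReal (s + κ) :=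
    hsurf.trans_lt ((ENNReal.ofReal_lt_ofReal_iff (by linarith)).2 (by linarith))
  -- A liminf only provides some radii `r < κ` with a good quotient; one is enough.
  obtain ⟨r, hr, hr0, hrκ⟩ := ((frequently_lt_of_liminf_lt (by isBoundedDefault) hlt).and_eventually
    (Ioo_mem_nhdsGT hκ)).exists
  refine (integral_abs_indicator_sub_partialRotation_le_thickening hA hθ hr0).trans ?_
  have hq : (gauss n).real (Metric.cthickening r A \ A) / r ≤ s + κ := by
    have := ENNReal.toReal_mono ENNReal.ofReal_ne_top hr.le
    rwa [ENNReal.toReal_div, ENNReal.toReal_ofReal hr0.le,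
      ENNReal.toReal_ofReal (by linarith)] at this
  exact mul_le_mul (by linarith) hq (div_nonneg measureReal_nonneg hr0.le) (by linarith)

theorem IsBoolean.integrable {f : Space n → ℝ} (hf : IsBoolean f) : Integrable f (gauss n) := by
  refine Integrable.of_bound (C := 1) hf.1.aestronglyMeasurable (Eventually.of_forall fun x ↦ ?_)
  rcases hf.2 x with h | h <;> simp [h]

theorem IsBoolean.integral_abs_sub_partialRotation_le {g : Space n → ℝ} (hg : IsBoolean g)
    {θ s : ℝ} (hθ : 0 ≤ θ) (hs : 0 ≤ s) (hsurf : surf g ≤ ENNReal.ofReal s) :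
    ∫ p, |g p.1 - g (partialRotation ⊤ θ p)| ∂((gauss n).prod (gauss n)) ≤ 2 * (θ * s) := by
  have hA : MeasurableSet {x | g x = 1} := hg.1 (measurableSet_singleton 1)
  have h := integral_abs_indicator_sub_partialRotation_le hA hθ hs hsurf
  have heq (x : Space n) : g x = 2 * {x | g x = 1}.indicator (fun _ ↦ (1 : ℝ)) x - 1 := by
    rcases hg.2 x with hx | hx
    · have : x ∉ {x | g x = 1} := by simp only [Set.mem_ofPred_eq, hx]; norm_num
      rw [Set.indicator_of_notMem this, hx]; norm_num
    · have : x ∈ {x | g x = 1} := hx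
      rw [Set.indicator_of_mem this, hx]; norm_num
  have heq' (p : Space n × Space n) : |g p.1 - g (partialRotation ⊤ θ p)|
      = 2 * |{x | g x = 1}.indicator (fun _ ↦ (1 : ℝ)) p.1
        - {x | g x = 1}.indicator (fun _ ↦ (1 : ℝ)) (partialRotation ⊤ θ p)| := by
    rw [heq p.1, heq (partialRotation ⊤ θ p), ← abs_two, ← abs_mul, abs_two]
    congr 1
    ring
  simp_rw [heq']
  rw [integral_const_mul]
  linarith

end SurfaceArea

/-! ### Gaussian translations and the Lipschitz bound for `P_t f` -/

section TotalVariation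

theorem integral_gaussianReal_add_const (ψ : ℝ → ℝ) (c : ℝ) :
    ∫ x, ψ (x + c) ∂(gaussianReal 0 1)
      = ∫ x, Real.exp (c * x - c ^ 2 / 2) * ψ x ∂(gaussianReal 0 1) := by
  have h1 : ∫ x, ψ (x + c) ∂(gaussianReal 0 1) = ∫ x, ψ x ∂(gaussianReal c 1) := by
    have h := gaussianReal_map_add_const (μ := 0) (v := 1) c
    rw [zero_add] at h
    rw [← h]
    exact ((measurableEmbedding_addRight c).integral_map ψ).symm
  rw [h1, integral_gaussianReal_eq_integral_smul one_ne_zero,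
    integral_gaussianReal_eq_integral_smul one_ne_zero]
  refine integral_congr_ae (Eventually.of_forall fun x ↦ ?_)
  simp only [gaussianPDFReal_def, smul_eq_mul]
  rw [← mul_assoc, mul_assoc _ (Real.exp _) (Real.exp _), ← Real.exp_add]
  congr 3
  simp only [NNReal.coe_one]
  ring

/-- The second moment is exactly `e^{c²} - 1`, at most `2c²` when `|c| ≤ 1`; then compare `L¹` with
`L²`. -/
theorem integral_abs_exp_sub_one_le {c : ℝ} (hc : |c| ≤ 1) :
    ∫ x, |Real.exp (c * x - c ^ 2 / 2) - 1| ∂(gaussianReal 0 1) ≤ 2 * |c| := by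
  have hi (a : ℝ) := integrable_exp_mul_gaussianReal (μ := 0) (v := 1) a
  have hv (a : ℝ) : ∫ x, Real.exp (a * x) ∂(gaussianReal 0 1) = Real.exp (a ^ 2 / 2) := by
    have := congrFun (mgf_fun_id_gaussianReal (μ := 0) (v := 1)) a
    simpa [mgf] using this
  have hsq (x : ℝ) : (Real.exp (c * x - c ^ 2 / 2) - 1) ^ 2
      = Real.exp (-c ^ 2) * Real.exp (2 * c * x)
        - 2 * Real.exp (-c ^ 2 / 2) * Real.exp (c * x) + 1 := by
    have e1 : Real.exp (c * x - c ^ 2 / 2) = Real.exp (-c ^ 2 / 2) * Real.exp (c * x) := by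
      rw [← Real.exp_add]; ring_nf
    have e2 : Real.exp (-c ^ 2) = Real.exp (-c ^ 2 / 2) ^ 2 := by
      rw [← Real.exp_nat_mul]; push_cast; ring_nf
    have e3 : Real.exp (2 * c * x) = Real.exp (c * x) ^ 2 := by
      rw [← Real.exp_nat_mul]; push_cast; ring_nf
    rw [e1, e2, e3]
    ring
  have i1 := (hi (2 * c)).const_mul (Real.exp (-c ^ 2))
  have i2 := (hi c).const_mul (2 * Real.exp (-c ^ 2 / 2))
  have i12 : Integrable (fun x ↦ Real.exp (-c ^ 2) * Real.exp (2 * c * x)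
      - 2 * Real.exp (-c ^ 2 / 2) * Real.exp (c * x)) (gaussianReal 0 1) := i1.sub i2
  have hint : Integrable (fun x ↦ (Real.exp (c * x - c ^ 2 / 2) - 1) ^ 2) (gaussianReal 0 1) := by
    simp_rw [hsq]
    exact i12.add (integrable_const 1)
  have hmem : MemLp (fun x ↦ Real.exp (c * x - c ^ 2 / 2) - 1) 2 (gaussianReal 0 1) :=
    (memLp_two_iff_integrable_sq (Measurable.aestronglyMeasurable (by fun_prop))).2 hint
  refine integral_abs_le_of_integral_sq_le hmem (by positivity) ?_
  have hval : ∫ x, (Real.exp (c * x - c ^ 2 / 2) - 1) ^ 2 ∂(gaussianReal 0 1)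
      = Real.exp (c ^ 2) - 1 := by
    simp_rw [hsq]
    rw [integral_add i12 (integrable_const 1), integral_sub i1 i2, integral_const_mul,
      integral_const_mul, hv, hv, ← Real.exp_add, mul_assoc, ← Real.exp_add]
    have a1 : -c ^ 2 + (2 * c) ^ 2 / 2 = c ^ 2 := by ring
    have a2 : -c ^ 2 / 2 + c ^ 2 / 2 = 0 := by ring
    rw [a1, a2]
    simp
    ring
  rw [hval]
  have hc2 : |c ^ 2| ≤ 1 := by
    rw [abs_pow]; exact pow_le_one₀ (abs_nonneg c) hc
  have h := (abs_le.1 (Real.abs_exp_sub_one_le hc2)).2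
  rw [abs_of_nonneg (sq_nonneg c)] at h
  rw [mul_pow, sq_abs]
  nlinarith [sq_nonneg c]

/-- For `|c| ≤ 1` compare the densities; for `|c| ≥ 1` the trivial bound `2` suffices. -/
theorem abs_integral_gaussianReal_add_sub_le {ψ : ℝ → ℝ} (hψ : Measurable ψ)
    (hb : ∀ x, |ψ x| ≤ 1) (c : ℝ) :
    |∫ x, ψ (x + c) ∂(gaussianReal 0 1) - ∫ x, ψ x ∂(gaussianReal 0 1)| ≤ 2 * |c| := by
  have hi (η : ℝ → ℝ) (hη : Measurable η) (hb : ∀ x, |η x| ≤ 1) :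
      Integrable η (gaussianReal 0 1) :=
    Integrable.of_bound (C := 1) hη.aestronglyMeasurable (Eventually.of_forall hb)
  have hle (η : ℝ → ℝ) (hb : ∀ x, |η x| ≤ 1) : |∫ x, η x ∂(gaussianReal 0 1)| ≤ 1 := by
    have := norm_integral_le_of_norm_le_const (μ := gaussianReal 0 1) (f := η) (C := 1)
      (Eventually.of_forall hb)
    simpa using this
  rcases le_total |c| 1 with hc | hc
  · have hexp : Integrable (fun x ↦ Real.exp (c * x - c ^ 2 / 2)) (gaussianReal 0 1) := by
      have := (integrable_exp_mul_gaussianReal (μ := 0) (v := 1) c).const_mul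
        (Real.exp (-c ^ 2 / 2))
      refine this.congr (Eventually.of_forall fun x ↦ ?_)
      simp only
      rw [← Real.exp_add]
      ring_nf
    have hprod : Integrable (fun x ↦ Real.exp (c * x - c ^ 2 / 2) * ψ x) (gaussianReal 0 1) :=
      hexp.mul_bdd (c := 1) hψ.aestronglyMeasurable (Eventually.of_forall hb)
    rw [integral_gaussianReal_add_const, ← integral_sub hprod (hi ψ hψ hb)]
    refine (abs_integral_le_integral_abs).trans (le_trans ?_ (integral_abs_exp_sub_one_le hc))
    refine integral_mono (hprod.sub (hi ψ hψ hb)).abs (hexp.sub (integrable_const 1)).abs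
      fun x ↦ ?_
    have : Real.exp (c * x - c ^ 2 / 2) * ψ x - ψ x
      = (Real.exp (c * x - c ^ 2 / 2) - 1) * ψ x := by ring
    simp only [this, abs_mul]
    exact mul_le_of_le_one_right (abs_nonneg _) (hb x)
  · have h1 := hle (fun x ↦ ψ (x + c)) fun x ↦ hb _
    have h2 := hle ψ hb
    exact (abs_sub _ _).trans (by linarith)

variable {n : ℕ}

theorem map_inner_gauss {u : Space n} (hu : ‖u‖ = 1) :
    (gauss n).map (fun z ↦ inner ℝ u z) = gaussianReal 0 1 := by
  have h := IsGaussian.map_eq_gaussianReal (μ := gauss n) (innerSL ℝ u)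
  have h1 : (gauss n)[innerSL ℝ u] = 0 :=
    integral_strongDual_stdGaussian (E := Space n) (innerSL ℝ u)
  have h2 : variance (innerSL ℝ u) (gauss n) = 1 := by
    have := variance_dual_stdGaussian (E := Space n) (innerSL ℝ u)
    rwa [innerSL_apply_norm, hu, one_pow] at this
  rw [h1, h2, Real.toNNReal_one] at h
  exact h

/-- Translating the Gaussian measure by `v` moves the integral of a function bounded by `1` by at
most `2 ‖v‖`. -/
theorem abs_integral_gauss_add_sub_le {h : Space n → ℝ} (hm : Measurable h) (hb : ∀ x, |h x| ≤ 1)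
    (v : Space n) :
    |∫ z, h (z + v) ∂(gauss n) - ∫ z, h z ∂(gauss n)| ≤ 2 * ‖v‖ := by
  rcases eq_or_ne v 0 with rfl | hv
  · simp
  set u : Space n := ‖v‖⁻¹ • v with hu
  have hv0 : ‖v‖ ≠ 0 := norm_ne_zero_iff.2 hv
  have hu1 : ‖u‖ = 1 := by rw [hu, norm_smul, norm_inv, norm_norm, inv_mul_cancel₀ hv0]
  have hvu : v = ‖v‖ • u := by rw [hu, smul_smul, mul_inv_cancel₀ hv0, one_smul]
  -- A quarter turn in the line of `v` resamples only the coordinate along `v`, which reduces the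
  -- claim to dimension one by Fubini.
  set W : Submodule ℝ (Space n) := ℝ ∙ u
  have hproj (z : Space n) : W.starProjection z = inner ℝ u z • u :=
    Submodule.starProjection_unit_singleton ℝ hu1 z
  have hmp := measurePreserving_partialRotation W (Real.pi / 2)
  have hrot (p : Space n × Space n) : partialRotation W (Real.pi / 2) p
      = p.1 - W.starProjection p.1 + inner ℝ u p.2 • u := by
    rw [partialRotation, hproj p.2]; simp
  have hfub (w : Space n) : ∫ z, h (z + w) ∂(gauss n) = ∫ z, ∫ x,
      h (z - W.starProjection z + x • u + w) ∂(gaussianReal 0 1) ∂(gauss n) := by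
    have hmw : Measurable fun z ↦ h (z + w) := by fun_prop
    conv_lhs => rw [← hmp.map_eq]
    rw [integral_map hmp.measurable.aemeasurable hmw.aestronglyMeasurable, integral_prod]
    · refine integral_congr_ae (Eventually.of_forall fun z ↦ ?_)
      simp only [hrot]
      rw [← map_inner_gauss hu1, integral_map (Measurable.aemeasurable (by fun_prop))
        (Measurable.aestronglyMeasurable (by fun_prop))]
    · exact Integrable.of_bound (C := 1) (hmw.comp hmp.measurable).aestronglyMeasurable
        (Eventually.of_forall fun p ↦ hb _)
  have hinner (w : Space n) : Integrable (fun z ↦ ∫ x,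
      h (z - W.starProjection z + x • u + w) ∂(gaussianReal 0 1)) (gauss n) := by
    have : Integrable (fun p : Space n × ℝ ↦ h (p.1 - W.starProjection p.1 + p.2 • u + w))
        ((gauss n).prod (gaussianReal 0 1)) :=
      Integrable.of_bound (C := 1) (Measurable.aestronglyMeasurable (by fun_prop))
        (Eventually.of_forall fun p ↦ hb _)
    exact this.integral_prod_left
  have h0 := hfub 0
  have hinner0 := hinner 0
  simp only [add_zero] at h0 hinner0
  rw [hfub v, h0, ← integral_sub (hinner v) hinner0]
  have hbound := norm_integral_le_of_norm_le_const (μ := gauss n) (C := 2 * ‖v‖)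
    (f := fun z ↦ ∫ x, h (z - W.starProjection z + x • u + v) ∂(gaussianReal 0 1)
      - ∫ x, h (z - W.starProjection z + x • u) ∂(gaussianReal 0 1))
    (Eventually.of_forall fun z ↦ ?_)
  · simpa using hbound
  · have h1 := abs_integral_gaussianReal_add_sub_le
      (ψ := fun x ↦ h (z - W.starProjection z + x • u)) (by fun_prop) (fun x ↦ hb _) ‖v‖
    rw [abs_norm] at h1
    have hx (x : ℝ) : z - W.starProjection z + x • u + v
        = z - W.starProjection z + (x + ‖v‖) • u := by
      rw [add_smul, ← hvu, add_assoc]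
    simp only [Real.norm_eq_abs, hx]
    exact h1

theorem IsBoolean.abs_le_one {f : Space n → ℝ} (hf : IsBoolean f) (x : Space n) : |f x| ≤ 1 := by
  rcases hf.2 x with h | h <;> simp [h]

theorem exp_div_sqrt_le {t : ℝ} (ht : 0 < t) :
    Real.exp (-t) / Real.sqrt (1 - Real.exp (-2 * t)) ≤ 1 / Real.sqrt (2 * t) := by
  have h1 : Real.exp (-2 * t) < 1 := Real.exp_lt_one_iff.2 (by linarith)
  have h2 : Real.exp (-2 * t) = Real.exp (-t) ^ 2 := by
    rw [← Real.exp_nat_mul]; push_cast; ring_nf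
  have h3 : Real.exp (-2 * t) * Real.exp (2 * t) = 1 := by
    rw [← Real.exp_add]; simp
  have h4 := Real.add_one_le_exp (2 * t)
  rw [div_le_div_iff₀ (Real.sqrt_pos.2 (by linarith)) (Real.sqrt_pos.2 (by linarith)), one_mul]
  refine Real.le_sqrt_of_sq_le ?_
  rw [mul_pow, ← h2, Real.sq_sqrt (by linarith)]
  nlinarith [Real.exp_pos (-2 * t)]

/-- Moving the base point from `x` to `y` amounts to translating the noise by `(a / b) • (y - x)`.
-/
theorem lipschitzWith_ouSemigroup {f : Space n → ℝ} (hf : IsBoolean f) {t : ℝ} (ht : 0 < t) :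
    LipschitzWith (2 / Real.sqrt (2 * t)).toNNReal (ouSemigroup t f) := by
  refine LipschitzWith.of_dist_le_mul fun y x ↦ ?_
  rw [Real.coe_toNNReal _ (by positivity), Real.dist_eq, dist_eq_norm]
  set a := Real.exp (-t) with ha
  set b := Real.sqrt (1 - Real.exp (-2 * t)) with hb
  have hb0 : 0 < b := Real.sqrt_pos.2 (by
    have : Real.exp (-2 * t) < 1 := Real.exp_lt_one_iff.2 (by linarith)
    linarith)
  have hm := hf.1
  have h := abs_integral_gauss_add_sub_le (h := fun z ↦ f (a • x + b • z)) (by fun_prop)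
    (fun z ↦ hf.abs_le_one _) ((a / b) • (y - x))
  have hz (z : Space n) : a • x + b • (z + (a / b) • (y - x)) = a • y + b • z := by
    rw [smul_add, smul_smul, mul_div_cancel₀ _ hb0.ne']
    module
  simp only [hz] at h
  refine h.trans ?_
  rw [norm_smul, Real.norm_eq_abs, abs_of_nonneg (by positivity), ← mul_assoc]
  refine mul_le_mul_of_nonneg_right ?_ (norm_nonneg _)
  have := exp_div_sqrt_le ht
  calc 2 * (a / b) ≤ 2 * (1 / Real.sqrt (2 * t)) := by linarith
    _ = _ := by ring

end TotalVariation

/-! ### The distance from `f` to `P_t f` -/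

section OrnsteinUhlenbeck

variable {n : ℕ}

/-- Equivalent to `cos θ ≤ e^{-θ²/2}`: the product `cos x · e^{x²/2}` decreases on `[0, π/2)`
because `x ≤ tan x`. -/
theorem arccos_exp_neg_le {t : ℝ} (ht : 0 ≤ t) :
    Real.arccos (Real.exp (-t)) ≤ Real.sqrt (2 * t) := by
  set θ := Real.arccos (Real.exp (-t)) with hθ
  have hθ0 : 0 ≤ θ := Real.arccos_nonneg _
  have hθ1 : θ < Real.pi / 2 := Real.arccos_lt_pi_div_two.2 (Real.exp_pos _)
  have hcos : Real.cos θ = Real.exp (-t) :=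
    Real.cos_arccos (by linarith [Real.exp_pos (-t)]) (Real.exp_le_one_iff.2 (by linarith))
  have hanti : AntitoneOn (fun x ↦ Real.cos x * Real.exp (x ^ 2 / 2)) (Set.Ico 0 (Real.pi / 2)) := by
    have hd (x : ℝ) : HasDerivAt (fun x ↦ Real.cos x * Real.exp (x ^ 2 / 2))
        ((x * Real.cos x - Real.sin x) * Real.exp (x ^ 2 / 2)) x := by
      have h := (Real.hasDerivAt_cos x).mul (((hasDerivAt_pow 2 x).div_const 2).exp)
      refine h.congr_deriv ?_
      push_cast
      ring
    refine antitoneOn_of_deriv_nonpos (convex_Ico _ _) (by fun_prop)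
      (fun x _ ↦ (hd x).differentiableAt.differentiableWithinAt) fun x hx ↦ ?_
    rw [interior_Ico] at hx
    rw [(hd x).deriv]
    have hc : 0 < Real.cos x := Real.cos_pos_of_mem_Ioo ⟨by linarith [hx.1], hx.2⟩
    have h := Real.le_tan hx.1.le hx.2
    rw [Real.tan_eq_sin_div_cos, le_div_iff₀ hc] at h
    exact mul_nonpos_of_nonpos_of_nonneg (by linarith) (Real.exp_pos _).le
  have h := hanti ⟨le_refl _, by positivity⟩ ⟨hθ0, hθ1⟩ hθ0
  simp only [hcos, ← Real.exp_add] at h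
  have h' : -t + θ ^ 2 / 2 ≤ 0 := by
    rw [← Real.exp_le_one_iff]
    simpa using h
  exact Real.le_sqrt_of_sq_le (by linarith)

theorem partialRotation_top_arccos {t : ℝ} (ht : 0 ≤ t) (p : Space n × Space n) :
    partialRotation ⊤ (Real.arccos (Real.exp (-t))) p
      = Real.exp (-t) • p.1 + Real.sqrt (1 - Real.exp (-2 * t)) • p.2 := by
  have h : Real.exp (-2 * t) = Real.exp (-t) ^ 2 := by
    rw [← Real.exp_nat_mul]; push_cast; ring_nf
  rw [partialRotation, Real.cos_arccos (by linarith [Real.exp_pos (-t)])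
    (Real.exp_le_one_iff.2 (by linarith)), Real.sin_arccos, h,
    Submodule.starProjection_eq_self_iff.2 Submodule.mem_top,
    Submodule.starProjection_eq_self_iff.2 Submodule.mem_top, sub_self, zero_add]

theorem dist1_ouSemigroup_le {f : Space n → ℝ} (hf : IsBoolean f) {t : ℝ} (ht : 0 ≤ t) :
    dist1 f (ouSemigroup t f)
      ≤ ∫ p, |f p.1 - f (partialRotation ⊤ (Real.arccos (Real.exp (-t))) p)|
          ∂((gauss n).prod (gauss n)) := by
  set θ := Real.arccos (Real.exp (-t)) with hθ
  have hint := integrable_abs_sub_partialRotation_of_integrable ⊤ θ hf.integrable hf.integrable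
  have hcomp := (measurePreserving_partialRotation (⊤ : Submodule ℝ (Space n)) θ)
    |>.integrable_comp_of_integrable hf.integrable
  rw [integral_prod _ hint, dist1]
  refine integral_mono_of_nonneg (Eventually.of_forall fun x ↦ abs_nonneg _)
    hint.integral_prod_left ?_
  filter_upwards [hcomp.prod_right_ae] with x hx
  have hx : Integrable (fun z ↦ f (partialRotation ⊤ θ (x, z))) (gauss n) := hx
  have heq : f x - ouSemigroup t f x = ∫ z, (f x - f (partialRotation ⊤ θ (x, z))) ∂(gauss n) := by
    rw [integral_sub (integrable_const _) hx, ouSemigroup]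
    simp [hθ, partialRotation_top_arccos ht]
  rw [heq]
  exact abs_integral_le_integral_abs

theorem IsSmooth.dist1_ouSemigroup_le {f : Space n → ℝ} {η s : ℝ} (hf : IsBoolean f)
    (hη : 0 ≤ η) (hs : 0 ≤ s) (hsm : IsSmooth η s f) {t : ℝ} (ht : 0 ≤ t) :
    dist1 f (ouSemigroup t f) ≤ 2 * η + 2 * (Real.sqrt (2 * t) * (s * (1 + η))) := by
  obtain ⟨g, hg, hfg, hsurf⟩ := hsm
  have hs' : 0 ≤ s * (1 + η) := by positivity
  have h1 := LinearJunta.dist1_ouSemigroup_le hf ht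
  have h2 := integral_abs_sub_partialRotation_le_add ⊤ (Real.arccos (Real.exp (-t)))
    hf.integrable hg.integrable
  have h3 := hg.integral_abs_sub_partialRotation_le (Real.arccos_nonneg (Real.exp (-t))) hs' hsurf
  have h4 := mul_le_mul_of_nonneg_right (arccos_exp_neg_le ht) hs'
  rw [dist1] at hfg
  linarith

end OrnsteinUhlenbeck

/-! ### Consequences of being far from juntas -/

section Juntas

variable {n : ℕ}

/-- The function sees `x` only through its component in `Wᗮ`, whose dimension is the codimension of
`W`. -/
theorem isLinearJunta_comp_sub_starProjection {f : Space n → ℝ} (hf : IsBoolean f) {k : ℕ}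
    {W : Submodule ℝ (Space n)} (hW : Module.finrank ℝ (Space n ⧸ W) ≤ k) (w : Space n) :
    IsLinearJunta k (fun x ↦ f (x - W.starProjection x + w)) := by
  have hm := hf.1
  have hdim : Module.finrank ℝ Wᗮ ≤ k := by
    have h1 := W.finrank_quotient_add_finrank
    have h2 := W.finrank_add_finrank_orthogonal
    omega
  set b := stdOrthonormalBasis ℝ Wᗮ with hb
  refine ⟨Module.finrank ℝ Wᗮ, hdim, fun i ↦ b i,
    b.orthonormal.comp_linearIsometry Wᗮ.subtypeₗᵢ,
    fun c ↦ f ((∑ i, c i • (b i : Space n)) + w), by fun_prop, fun x ↦ ?_⟩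
  have h : x - W.starProjection x = ∑ i, inner ℝ (b i : Space n) x • (b i : Space n) := by
    rw [← W.starProjection_orthogonal_val, b.starProjection_eq_sum_rankOne]
    simp [InnerProductSpace.rankOne_apply]
  simp only [h]

theorem IsFarFromLinearJuntas.le_integral {f : Space n → ℝ} (hf : IsBoolean f) {ε : ℝ} {k : ℕ}
    (hfar : IsFarFromLinearJuntas ε k f) {W : Submodule ℝ (Space n)}
    (hW : Module.finrank ℝ (Space n ⧸ W) ≤ k) :
    ε ≤ ∫ p, |f p.1 - f (partialRotation W (Real.pi / 2) p)| ∂((gauss n).prod (gauss n)) := by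
  have hm := hf.1
  have hint := integrable_abs_sub_partialRotation_of_integrable W (Real.pi / 2)
    hf.integrable hf.integrable
  rw [integral_prod_symm _ hint]
  have hε : ε = ∫ _ : Space n, ε ∂(gauss n) := by simp
  rw [hε]
  refine integral_mono (integrable_const _) hint.integral_prod_right fun z ↦ ?_
  have h := hfar (fun x ↦ f (x - W.starProjection x + W.starProjection z))
    ⟨by fun_prop, fun x ↦ hf.2 _⟩ (isLinearJunta_comp_sub_starProjection hf hW _)
  simpa [dist1, partialRotation] using h

/-- Constants are `0`-juntas. The bound later trades `ε ^ 2` for a multiple of `ε`. -/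
theorem IsFarFromLinearJuntas.le_two {f : Space n → ℝ} (hf : IsBoolean f) {ε : ℝ} {k : ℕ}
    (hfar : IsFarFromLinearJuntas ε k f) : ε ≤ 2 := by
  have h := hfar (fun _ ↦ 1) ⟨measurable_const, fun _ ↦ Or.inr rfl⟩
    ⟨0, Nat.zero_le k, Fin.elim0, ⟨fun i ↦ i.elim0, fun i ↦ i.elim0⟩, fun _ ↦ 1,
      measurable_const, fun _ ↦ rfl⟩
  refine h.trans ?_
  have h1 := (hf.integrable.sub (integrable_const 1)).abs
  have h2 : dist1 f (fun _ ↦ 1) ≤ ∫ _ : Space n, (2 : ℝ) ∂(gauss n) := by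
    refine integral_mono h1 (integrable_const 2) fun x ↦ ?_
    rcases hf.2 x with hx | hx <;> norm_num [hx]
  simpa using h2

end Juntas

/-- If a nonnegative function bounded by `L` has mean at most `m`, it exceeds `a` with probability
at least `(m - a) / L`. -/
theorem integral_le_add_mul_measureReal {Ω : Type*} [MeasurableSpace Ω] {μ : Measure Ω}
    [IsProbabilityMeasure μ] {G : Ω → ℝ} (hG : Measurable G) {L a b : ℝ} (h0 : ∀ ω, 0 ≤ G ω)
    (hL : ∀ ω, G ω ≤ L) (ha : 0 ≤ a) (hab : b ≤ a ^ 2) :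
    ∫ ω, G ω ∂μ ≤ a + L * μ.real {ω | b ≤ G ω ^ 2} := by
  have hS : MeasurableSet {ω | b ≤ G ω ^ 2} := measurableSet_le measurable_const (hG.pow_const 2)
  have hint : Integrable G μ := Integrable.of_bound (C := L) hG.aestronglyMeasurable
    (Eventually.of_forall fun ω ↦ by rw [Real.norm_eq_abs, abs_of_nonneg (h0 ω)]; exact hL ω)
  have hind : Integrable ({ω | b ≤ G ω ^ 2}.indicator fun _ ↦ L) μ :=
    (integrable_const L).indicator hS
  calc ∫ ω, G ω ∂μ ≤ ∫ ω, (a + {ω | b ≤ G ω ^ 2}.indicator (fun _ ↦ L) ω) ∂μ := by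
        refine integral_mono hint ((integrable_const a).add hind) fun ω ↦ ?_
        by_cases hω : ω ∈ {ω | b ≤ G ω ^ 2}
        · simp only [Set.indicator_of_mem hω]
          linarith [hL ω]
        · simp only [Set.indicator_of_notMem hω, add_zero]
          have hlt : G ω ^ 2 < b := not_le.1 hω
          exact (abs_le_of_sq_le_sq' (by linarith) ha).2
    _ = _ := by
        rw [integral_add (integrable_const a) hind, integral_indicator_const _ hS]
        simp [mul_comm]

end LinearJunta

/-! ### Assembling the estimates -/

open LinearJunta in
theorem lemma3p9 :
    ∃ c : ℝ, 0 < c ∧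
      ∀ (n k : ℕ) (ε s : ℝ), 0 < ε → 0 < s →
      ∀ f : Space n → ℝ, IsBoolean f → IsSmooth ((ε / 30) ^ 2) s f →
        IsFarFromLinearJuntas ε k f →
      ∀ W : Submodule ℝ (Space n), Module.finrank ℝ (Space n ⧸ W) ≤ k →
        c * (ε ^ 6 / s ^ 2) ≤
          (gauss n).real {y | ε ^ 2 / 8 ≤
            ‖W.starProjection (gradient (ouSemigroup (ε ^ 4 / (900 * s ^ 2)) f) y)‖ ^ 2} := by
  refine ⟨(7 / 10000) ^ 2, by norm_num, fun n k ε s hε hs f hf hsm hfar W hW ↦ ?_⟩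
  set t := ε ^ 4 / (900 * s ^ 2) with ht
  have ht0 : 0 < t := by positivity
  set F := ouSemigroup t f with hF
  set q := Real.sqrt (2 * t) with hq
  have hq0 : 0 < q := Real.sqrt_pos.2 (by linarith)
  have hlip : LipschitzWith (2 / q).toNNReal F := lipschitzWith_ouSemigroup hf ht0
  have hFint : Integrable F (gauss n) := by
    refine Integrable.of_bound (C := 1) hlip.continuous.aestronglyMeasurable
      (Eventually.of_forall fun x ↦ ?_)
    have h := norm_integral_le_of_norm_le_const (μ := gauss n) (C := 1)
      (f := fun z ↦ f (Real.exp (-t) • x + Real.sqrt (1 - Real.exp (-2 * t)) • z))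
      (Eventually.of_forall fun z ↦ hf.abs_le_one _)
    rwa [probReal_univ, mul_one] at h
  have hdist : ∫ x, |f x - F x| ∂(gauss n)
      ≤ 2 * (ε / 30) ^ 2 + 2 * (q * (s * (1 + (ε / 30) ^ 2))) :=
    hsm.dist1_ouSemigroup_le hf (by positivity) hs.le ht0.le
  have hfarW := hfar.le_integral hf hW
  have hε2 := hfar.le_two hf
  have htri := integral_abs_sub_partialRotation_le_add W (Real.pi / 2) hf.integrable hFint
  have hgrad := integral_abs_sub_partialRotation_le W hlip (θ := Real.pi / 2) (by positivity)
  -- The threshold `0.354` is just above `1/√8`, the square root of the constant in the statement.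
  have hmark := integral_le_add_mul_measureReal (μ := gauss n)
    (measurable_starProjection_gradient W F).norm (L := 2 / q) (a := 0.354 * ε) (b := ε ^ 2 / 8)
    (fun x ↦ norm_nonneg _)
    (fun x ↦ by
      have h := (W.norm_starProjection_apply_le _).trans (norm_gradient_le hlip x)
      rwa [Real.coe_toNNReal _ (by positivity)] at h)
    (by positivity) (by nlinarith [sq_nonneg ε])
  set G := ∫ x, ‖W.starProjection (gradient F x)‖ ∂(gauss n) with hG
  set p := (gauss n).real {y | ε ^ 2 / 8 ≤ ‖W.starProjection (gradient F y)‖ ^ 2} with hp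
  have hp0 : 0 ≤ p := measureReal_nonneg
  have hp1 : p ≤ 1 := measureReal_le_one
  have hG0 : 0 ≤ G := integral_nonneg fun x ↦ norm_nonneg _
  have hqs : (q * s) ^ 2 = ε ^ 4 / 450 := by
    rw [mul_pow, hq, Real.sq_sqrt (by positivity), ht]
    field_simp
    norm_num
  -- The constants bracket `1/√450 ≈ 0.04714`.
  have hw1 : q * s ≤ 0.04715 * ε ^ 2 := by
    refine (abs_le_of_sq_le_sq' ?_ (by positivity)).2
    rw [hqs, mul_pow]
    nlinarith [pow_pos hε 4]
  have hw2 : 0.047 * ε ^ 2 ≤ q * s := by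
    refine (abs_le_of_sq_le_sq' ?_ (by positivity)).2
    rw [hqs, mul_pow]
    nlinarith [pow_pos hε 4]
  have hεsq : ε ^ 2 ≤ 2 * ε := by nlinarith
  have hη : (ε / 30) ^ 2 ≤ 4 / 900 := by nlinarith
  have hD : ∫ x, |f x - F x| ∂(gauss n) ≤ 0.194 * ε := by
    have h1 : q * (s * (1 + (ε / 30) ^ 2)) ≤ 0.04715 * ε ^ 2 * (1 + 4 / 900) := by
      rw [← mul_assoc]
      exact mul_le_mul hw1 (by linarith) (by positivity) (by positivity)
    nlinarith
  -- Farness leaves `1 - 2 · 0.194 = 0.612`, and `0.612 / 1.575 > 0.388`; the excess over `0.354` is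
  -- the `0.034` used next.
  have hGlow : 0.388 * ε ≤ G := by
    have h1 : Real.pi / 2 * G ≤ 1.575 * G :=
      mul_le_mul_of_nonneg_right (by linarith [Real.pi_lt_d2]) hG0
    linarith
  have hpq : 0.017 * ε * q ≤ p := by
    have h1 : 0.034 * ε ≤ 2 / q * p := by linarith
    rw [div_mul_eq_mul_div, le_div_iff₀ hq0] at h1
    linarith
  have hr : 7 / 10000 * (ε ^ 3 / s) ≤ p := by
    refine le_trans ?_ hpq
    rw [← mul_div_assoc, div_le_iff₀ hs]
    have := mul_le_mul_of_nonneg_left hw2 hε.le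
    nlinarith [pow_pos hε 3]
  have hr0 : 0 ≤ 7 / 10000 * (ε ^ 3 / s) := by positivity
  -- The linear bound in `ε³/s` is stronger than required: `p ≤ 1` gives `p² ≤ p`.
  calc (7 / 10000) ^ 2 * (ε ^ 6 / s ^ 2) = (7 / 10000 * (ε ^ 3 / s)) ^ 2 := by ring
    _ ≤ p ^ 2 := pow_le_pow_left₀ hr0 hr 2
    _ ≤ p := by nlinarith
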